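/- **Setting.** Let $K$ be a compact Lie group with Lie algebra $\mathfrak k$, and let $G$ be the (reductive) complexification of $K$: a complex Lie group $G$ that contains $K$ as a maximal compact subgroup, with $\mathfrak g:=\mathrm{Lie}(G)=\mathfrak k\otimes_{\mathbb R}\mathbb C$, and such that $K$ meets every connected component of $G$. Let $(Z,\omega,J)$ be a Kähler manifold with a holomorphic action of $G$ whose restriction to $K$ is isometric, i.e. preserves $\omega$. For $\xi\in\mathfrak g$ let $\sigma_z(\xi)\in T_zZ$ denote the infinitesimal action, and put $\mathfrak g_z=\{\eta\in\mathfrak g:\sigma_z(\eta)=0\}$, $\mathfrak k_z=\mathfrak g_z\cap\mathfrak k$. Let $\mu:Z\to\mathfrak k^*$ be a smooth $K$-equivariant moment map: $\mu(k\cdot z)=\mathrm{Ad}_k^*\,\mu(z)$ for $k\in K$, and $d\langle\mu,\xi\rangle|_z(v)=\omega(v,\sigma_z(\xi))$ for all $z\in Z$, $v\in T_zZ$, $\xi\in\mathfrak k$. The pairing of $\mu(z)$ with $\mathfrak k$ is extended $\mathbb C$-linearly to $\mathfrak g$: $\langle\mu(z),a+\sqrt{-1}\,b\rangle=\langle\mu(z),a\rangle+\sqrt{-1}\,\langle\mu(z),b\rangle$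 for $a,b\in\mathfrak k$. **Theorem ($\mu$-invariant).** Let $z\in Z$, $\xi\in\mathfrak k_z$, $\eta\in\mathfrak g_z$, and let $\phi:\mathfrak g\to\mathbb R$ be a (real) differentiable function with $\phi\circ\mathrm{Ad}_g=\phi$ for all $g\in G$; let $d\phi$ be its real differential. Then: 1. $\langle d\phi|_{\mathrm{Ad}_g\xi},\mathrm{Ad}_g\eta\rangle$ is independent of $g\in G$. 2. The function $\chi:G\to\mathbb C$, $$\chi(g):=\langle\mu(g\cdot z)-d\phi|_{\mathrm{Ad}_g\xi},\mathrm{Ad}_g\eta\rangle=\langle\mu(g\cdot z),\mathrm{Ad}_g\eta\rangle-\langle d\phi|_{\mathrm{Ad}_g\xi},\mathrm{Ad}_g\eta\rangle,$$ is constant on $G$. -/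

import Mathlib

open scoped Manifold ContDiff Topology

noncomputable section

/-!
# Hamiltonian actions on Kähler manifolds and their complexification

Conventions.  A complex manifold is a `ChartedSpace V Z` over a complex normed space `V` with
`IsManifold 𝓘(ℂ, V) ω Z` (holomorphic transition functions).  The same charts make `Z` a real
manifold over the underlying real space of `V`.  Mathlib's tangent space at a point is, by
definition, the model space (read in the preferred chart at that point), so a Lie group modelled on
`𝔤` has Lie algebra `T₁ G = 𝔤`, and `T_z Z = V`; the complex structure `J` of `T_z Z` is the
multiplication by `Complex.I` on `V`.
-/

/-- The adjoint action `Ad_g : 𝔤 → 𝔤`, the derivative at `1` of `x ↦ g x g⁻¹`, for a Lie group `G`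
over `𝕜` modelled on `𝔤`. -/
def lieAd (𝕜 : Type*) [NontriviallyNormedField 𝕜] {𝔤 : Type*} [NormedAddCommGroup 𝔤]
    [NormedSpace 𝕜 𝔤] {G : Type*} [TopologicalSpace G] [ChartedSpace 𝔤 G] [Group G] (g : G) :
    𝔤 →L[𝕜] 𝔤 :=
  (mfderiv 𝓘(𝕜, 𝔤) 𝓘(𝕜, 𝔤) (fun x : G => g * x * g⁻¹) 1 :
    GroupLieAlgebra 𝓘(𝕜, 𝔤) G →L[𝕜] TangentSpace 𝓘(𝕜, 𝔤) (g * 1 * g⁻¹))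

section Complexification

variable {𝔨 𝔤 : Type*} [NormedAddCommGroup 𝔨] [NormedSpace ℝ 𝔨]
  [NormedAddCommGroup 𝔤] [NormedSpace ℂ 𝔤]
  {K : Type*} [TopologicalSpace K] [ChartedSpace 𝔨 K] [Group K]
  {G : Type*} [TopologicalSpace G] [ChartedSpace 𝔤 G] [Group G]

/-- The differential at `1` of a homomorphism from a real Lie group `K` to a complex Lie group `G`,
an `ℝ`-linear map `𝔨 → 𝔤`. -/
def lieDiff (ι : K →* G) : 𝔨 →L[ℝ] 𝔤 :=
  (mfderiv 𝓘(ℝ, 𝔨) 𝓘(ℝ, 𝔤) ι 1 :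
    GroupLieAlgebra 𝓘(ℝ, 𝔨) K →L[ℝ] TangentSpace 𝓘(ℝ, 𝔤) (ι 1))

/-- `ι : K → G` exhibits the complex Lie group `G` as the (reductive) complexification of the
compact Lie group `K`: `K` is (via `ι`) a maximal compact subgroup of `G`, the Lie algebra of `G`
is `𝔨 ⊗_ℝ ℂ`, and `K` meets every connected component of `G`. (The last condition is what
`G = K exp(√-1 𝔨)` says about components.) -/
structure IsComplexification (ι : K →* G) : Prop where
  injective : Function.Injective ι
  smooth : ContMDiff 𝓘(ℝ, 𝔨) 𝓘(ℝ, 𝔤) ∞ ι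
  isBaseChange : IsBaseChange ℂ (lieDiff ι : 𝔨 →L[ℝ] 𝔤).toLinearMap
  maximal : ∀ H : Subgroup G, IsCompact (H : Set G) → ι.range ≤ H → H = ι.range
  meets_components : ∀ g : G, ∃ k : K, g ∈ connectedComponent (ι k)

/-- The canonical pairing of `α ∈ 𝔨*` with `A ∈ 𝔤 = 𝔨 ⊗ ℂ`: the value at `A` of the `ℂ`-linear
extension of `α`, i.e. `⟨α, a + √-1 b⟩ = α a + √-1 α b` for `a, b ∈ 𝔨`. -/
def complexPairing {ι : K →* G} (hι : IsComplexification (𝔨 := 𝔨) (𝔤 := 𝔤) ι)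
    (α : 𝔨 →L[ℝ] ℝ) (A : 𝔤) : ℂ :=
  hι.isBaseChange.lift (Complex.ofRealCLM.toLinearMap ∘ₗ α.toLinearMap) A

end Complexification

section Kahler

variable (V : Type*) [NormedAddCommGroup V] [NormedSpace ℂ V]
  (Z : Type*) [TopologicalSpace Z] [ChartedSpace V Z]

/-- A (not necessarily continuous) real 2-form on `Z`: an alternating `ℝ`-bilinear form on each
tangent space `T_z Z = V`. -/
abbrev TwoForm : Type _ := Z → V [⋀^Fin 2]→L[ℝ] ℝ

variable {V Z}

/-- The expression of a 2-form in a chart `c`: its pullback under `c⁻¹` (meaningful on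
`c.target`). -/
def TwoForm.inChart (Ω : TwoForm V Z) (c : OpenPartialHomeomorph Z V) (x : V) :
    V [⋀^Fin 2]→L[ℝ] ℝ :=
  (Ω (c.symm x)).compContinuousLinearMap
    (mfderiv 𝓘(ℝ, V) 𝓘(ℝ, V) c.symm x : V →L[ℝ] V)

/-- `Ω` is a Kähler form on the complex manifold `Z`: a smooth closed real 2-form, invariant under
the complex structure `J`, such that `⟨u, v⟩ = Ω(u, J v)` is positive definite. -/
structure IsKahlerForm (Ω : TwoForm V Z) : Prop where
  smooth : ∀ c ∈ atlas V Z, ContDiffOn ℝ ∞ (Ω.inChart c) c.target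
  closed : ∀ c ∈ atlas V Z, ∀ x ∈ c.target, extDeriv (Ω.inChart c) x = 0
  complex_invariant : ∀ (z : Z) (u v : V),
    Ω z ![Complex.I • u, Complex.I • v] = Ω z ![u, v]
  positive : ∀ (z : Z) (v : V), v ≠ 0 → 0 < Ω z ![v, Complex.I • v]

end Kahler

section Action

variable {𝔨 𝔤 V : Type*} [NormedAddCommGroup 𝔨] [NormedSpace ℝ 𝔨]
  [NormedAddCommGroup 𝔤] [NormedSpace ℂ 𝔤] [NormedAddCommGroup V] [NormedSpace ℂ V]
  {K : Type*} [TopologicalSpace K] [ChartedSpace 𝔨 K] [Group K]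
  {G : Type*} [TopologicalSpace G] [ChartedSpace 𝔤 G] [Group G]
  {Z : Type*} [TopologicalSpace Z] [ChartedSpace V Z] [MulAction G Z]

/-- The infinitesimal action `σ_z : 𝔨 → T_z Z` of `K` (acting through `ι`): the derivative at `1`
of `k ↦ k · z`. -/
def infinitesimalAction (ι : K →* G) (z : Z) : 𝔨 →L[ℝ] V :=
  (mfderiv 𝓘(ℝ, 𝔨) 𝓘(ℝ, V) (fun k : K => ι k • z) 1 :
    GroupLieAlgebra 𝓘(ℝ, 𝔨) K →L[ℝ] TangentSpace 𝓘(ℝ, V) (ι 1 • z))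

/-- The infinitesimal action `σ_z : 𝔤 → T_z Z` of the complex group `G`, a `ℂ`-linear map: the
derivative at `1` of `g ↦ g · z`. -/
def complexInfinitesimalAction (G : Type*) [TopologicalSpace G] [ChartedSpace 𝔤 G] [Group G]
    [MulAction G Z] (z : Z) : 𝔤 →L[ℂ] V :=
  (mfderiv 𝓘(ℂ, 𝔤) 𝓘(ℂ, V) (fun g : G => g • z) 1 :
    GroupLieAlgebra 𝓘(ℂ, 𝔤) G →L[ℂ] TangentSpace 𝓘(ℂ, V) ((1 : G) • z))

/-- The stabilizer Lie algebra `𝔨_z = {ξ ∈ 𝔨 | σ_z(ξ) = 0}`. -/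
def stabilizerLie (ι : K →* G) (z : Z) : Submodule ℝ 𝔨 :=
  LinearMap.ker (infinitesimalAction (V := V) ι z : 𝔨 →L[ℝ] V).toLinearMap

/-- The stabilizer Lie algebra `𝔤_z = {η ∈ 𝔤 | σ_z(η) = 0}`. -/
def complexStabilizerLie (V : Type*) [NormedAddCommGroup V] [NormedSpace ℂ V]
    (G : Type*) [TopologicalSpace G] [ChartedSpace 𝔤 G] [Group G]
    {Z : Type*} [TopologicalSpace Z] [ChartedSpace V Z] [MulAction G Z] (z : Z) :
    Submodule ℂ 𝔤 :=
  LinearMap.ker (complexInfinitesimalAction G z : 𝔤 →L[ℂ] V).toLinearMap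

/-- The group `K` (acting through `ι`) preserves the 2-form `Ω`. For a holomorphic action and a
Kähler form this says that `K` acts by isometries of the Kähler metric. -/
def PreservesForm (ι : K →* G) (Ω : TwoForm V Z) : Prop :=
  ∀ (k : K) (z : Z) (u v : V),
    Ω (ι k • z) ![(mfderiv 𝓘(ℝ, V) 𝓘(ℝ, V) (fun w : Z => ι k • w) z : V →L[ℝ] V) u,
      (mfderiv 𝓘(ℝ, V) 𝓘(ℝ, V) (fun w : Z => ι k • w) z : V →L[ℝ] V) v] = Ω z ![u, v]

/-- `μ : Z → 𝔨*` is an equivariant moment map for the action of `K` (through `ι`) on `(Z, Ω)`: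
`d⟨μ, ξ⟩(v) = Ω(v, σ_z(ξ))` and `μ(k · z) = Ad*_k μ(z)`, the latter in the form
`⟨μ(k · z), Ad_k ξ⟩ = ⟨μ(z), ξ⟩`. -/
structure IsMomentMap (ι : K →* G) (Ω : TwoForm V Z) (μ : Z → 𝔨 →L[ℝ] ℝ) : Prop where
  smooth : ContMDiff 𝓘(ℝ, V) 𝓘(ℝ, 𝔨 →L[ℝ] ℝ) ∞ μ
  differential : ∀ (z : Z) (v : V) (ξ : 𝔨),
    (mfderiv 𝓘(ℝ, V) 𝓘(ℝ, ℝ) (fun w : Z => μ w ξ) z : V →L[ℝ] ℝ) v =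
      Ω z ![v, infinitesimalAction ι z ξ]
  equivariant : ∀ (k : K) (z : Z) (ξ : 𝔨), μ (ι k • z) (lieAd ℝ k ξ) = μ z ξ

/-- The function `χ(g) = ⟨μ(g · z) - dφ|_{Ad_g ξ}, Ad_g η⟩`, i.e. the complex number
`⟨μ(g · z), Ad_g η⟩ - ⟨dφ|_{Ad_g ξ}, Ad_g η⟩`; here `dφ` is the (real) differential of the
real-valued function `φ` on `𝔤`, and `ξ ∈ 𝔨` is viewed in `𝔤`. -/
def muInvariant {ι : K →* G} (hι : IsComplexification (𝔨 := 𝔨) (𝔤 := 𝔤) ι)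
    (μ : Z → 𝔨 →L[ℝ] ℝ) (φ : 𝔤 → ℝ) (z : Z) (ξ : 𝔨) (η : 𝔤) (g : G) : ℂ :=
  complexPairing hι (μ (g • z)) (lieAd ℂ g η) -
    (fderiv ℝ φ (lieAd ℂ g (lieDiff ι ξ)) (lieAd ℂ g η) : ℝ)

end Action

end

/-! The two terms of `χ` are constant separately. For the `φ` term, differentiate `φ ∘ Ad_g = φ`
(`fderiv_lieAd_apply`). For `F(g) = ⟨μ(g·z), Ad_g η⟩`, the differential at `1` is `L ζ = ⟨μ(z), D ζ⟩
+ ⟨dμ(σ_z ζ), η⟩`, where `D` is the derivative of `g ↦ Ad_g η`. The first summand is `ℂ`-linear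
since `Ad` is holomorphic, the second since `η ∈ 𝔤_z` and `Ω` is `J`-invariant
(`IsKahlerForm.complexPairing_modelDeriv_I_smul`). Equivariance makes `F` constant on `K`, so `L`
kills `𝔨`, hence `𝔨 + √-1 𝔨 = 𝔤`. Right translation replaces `(z, η)` by `(g·z, Ad_g η)` and carries
`dF = 0` from `1` to every `g`. Thus `F` is locally constant, and it is constant because `K` meets
every component. -/

/-! ### Derivatives between model spaces. -/

section ModelDeriv

variable {𝕜 : Type*} [NontriviallyNormedField 𝕜]
  {E F E' : Type*} [NormedAddCommGroup E] [NormedSpace 𝕜 E] [NormedAddCommGroup F]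
  [NormedSpace 𝕜 F] [NormedAddCommGroup E'] [NormedSpace 𝕜 E']
  {M N P : Type*} [TopologicalSpace M] [ChartedSpace E M] [TopologicalSpace N] [ChartedSpace F N]
  [TopologicalSpace P] [ChartedSpace E' P]

/-- The manifold derivative, read as a map between the model spaces. -/
noncomputable def modelDeriv (𝕜 : Type*) [NontriviallyNormedField 𝕜] (E F : Type*)
    [NormedAddCommGroup E] [NormedSpace 𝕜 E] [NormedAddCommGroup F] [NormedSpace 𝕜 F]
    {M N : Type*} [TopologicalSpace M] [ChartedSpace E M] [TopologicalSpace N] [ChartedSpace F N]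
    (f : M → N) (x : M) : E →L[𝕜] F :=
  (mfderiv 𝓘(𝕜, E) 𝓘(𝕜, F) f x : TangentSpace 𝓘(𝕜, E) x →L[𝕜] TangentSpace 𝓘(𝕜, F) (f x))

theorem modelDeriv_comp {g : N → P} {f : M → N} {x : M}
    (hg : MDifferentiableAt 𝓘(𝕜, F) 𝓘(𝕜, E') g (f x))
    (hf : MDifferentiableAt 𝓘(𝕜, E) 𝓘(𝕜, F) f x) :
    modelDeriv 𝕜 E E' (g ∘ f) x = (modelDeriv 𝕜 F E' g (f x)).comp (modelDeriv 𝕜 E F f x) :=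
  mfderiv_comp x hg hf

theorem modelDeriv_const (c : N) (x : M) : modelDeriv 𝕜 E F (fun _ : M => c) x = 0 :=
  mfderiv_const

theorem HasMFDerivAt.modelDeriv_eq {f : M → N} {x : M} {f' : E →L[𝕜] F}
    (h : HasMFDerivAt 𝓘(𝕜, E) 𝓘(𝕜, F) f x f') : modelDeriv 𝕜 E F f x = f' :=
  h.mfderiv

theorem MDifferentiableAt.hasMFDerivAt_modelDeriv {f : M → N} {x : M}
    (h : MDifferentiableAt 𝓘(𝕜, E) 𝓘(𝕜, F) f x) :
    HasMFDerivAt 𝓘(𝕜, E) 𝓘(𝕜, F) f x (modelDeriv 𝕜 E F f x) :=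
  h.hasMFDerivAt

end ModelDeriv

/-! ### Passing from complex to real derivatives. -/

section Restrict

variable {E F : Type*} [NormedAddCommGroup E] [NormedSpace ℂ E] [NormedAddCommGroup F]
  [NormedSpace ℂ F]
  {M N : Type*} [TopologicalSpace M] [ChartedSpace E M] [TopologicalSpace N] [ChartedSpace F N]

theorem HasMFDerivAt.complexToReal {f : M → N} {x : M} {f' : E →L[ℂ] F}
    (h : HasMFDerivAt 𝓘(ℂ, E) 𝓘(ℂ, F) f x f') :
    HasMFDerivAt 𝓘(ℝ, E) 𝓘(ℝ, F) f x (f'.restrictScalars ℝ) :=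
  ⟨h.1, HasFDerivWithinAt.restrictScalars ℝ h.2⟩

theorem MDifferentiableAt.complexToReal {f : M → N} {x : M}
    (h : MDifferentiableAt 𝓘(ℂ, E) 𝓘(ℂ, F) f x) : MDifferentiableAt 𝓘(ℝ, E) 𝓘(ℝ, F) f x :=
  h.hasMFDerivAt_modelDeriv.complexToReal.mdifferentiableAt

theorem modelDeriv_restrictScalars {f : M → N} {x : M}
    (h : MDifferentiableAt 𝓘(ℂ, E) 𝓘(ℂ, F) f x) :
    modelDeriv ℝ E F f x = (modelDeriv ℂ E F f x).restrictScalars ℝ :=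
  h.hasMFDerivAt_modelDeriv.complexToReal.modelDeriv_eq

end Restrict

/-! ### Maps with vanishing differential. -/

section LocallyConstant

variable {E F : Type*} [NormedAddCommGroup E] [NormedSpace ℂ E] [NormedAddCommGroup F]
  [NormedSpace ℝ F] {M : Type*} [TopologicalSpace M] [ChartedSpace E M]
  [IsManifold 𝓘(ℂ, E) 1 M]

/-- A ball inside the target of a chart is convex, so the mean value inequality applies to `f` read
in that chart. -/
theorem isLocallyConstant_of_hasMFDerivAt_zero {f : M → F}
    (h : ∀ x, HasMFDerivAt 𝓘(ℝ, E) 𝓘(ℝ, F) f x (0 : E →L[ℝ] F)) : IsLocallyConstant f := by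
  rw [IsLocallyConstant.iff_eventually_eq]
  intro x
  set c := chartAt E x
  have hx : x ∈ c.source := mem_chart_source E x
  have hd : ∀ y ∈ c.target, HasFDerivAt (f ∘ c.symm) (0 : E →L[ℝ] F) y := by
    intro y hy
    have h1 : MDifferentiableAt 𝓘(ℝ, E) 𝓘(ℝ, E) c.symm y :=
      (mdifferentiableAt_atlas_symm (I := 𝓘(ℂ, E)) (chart_mem_atlas E x) hy).complexToReal
    have h2 := (h (c.symm y)).comp y h1.hasMFDerivAt_modelDeriv
    have h3 := h2.hasFDerivAt
    convert! h3 using 1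
  obtain ⟨r, hr, hb⟩ := Metric.isOpen_iff.1 c.open_target (c x) (c.map_source hx)
  have hconst : ∀ y ∈ Metric.ball (c x) r, f (c.symm y) = f (c.symm (c x)) := by
    intro y hy
    refine (convex_ball (c x) r).is_const_of_fderivWithin_eq_zero (𝕜 := ℝ) (f := f ∘ c.symm)
      (fun w hw => (hd w (hb hw)).differentiableAt.differentiableWithinAt) ?_ hy
      (Metric.mem_ball_self hr)
    intro w hw
    exact (hd w (hb hw)).hasFDerivWithinAt.fderivWithin
      (Metric.isOpen_ball.uniqueDiffWithinAt hw)
  filter_upwards [c.open_source.mem_nhds hx,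
    (c.continuousAt hx).preimage_mem_nhds (Metric.ball_mem_nhds (c x) hr)] with y hy hy'
  have := hconst (c y) hy'
  rwa [c.left_inv hy, c.left_inv hx] at this

end LocallyConstant

/-! ### The adjoint representation and its regularity. -/

section Adjoint

variable {𝕜 : Type*} [NontriviallyNormedField 𝕜] {𝔤 : Type*} [NormedAddCommGroup 𝔤]
  [NormedSpace 𝕜 𝔤] {G : Type*} [TopologicalSpace G] [ChartedSpace 𝔤 G] [Group G]

theorem lieAd_eq_modelDeriv (g : G) :
    lieAd 𝕜 g = modelDeriv 𝕜 𝔤 𝔤 (fun x : G => g * x * g⁻¹) 1 := rfl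

theorem lieAd_one : lieAd 𝕜 (1 : G) = ContinuousLinearMap.id 𝕜 𝔤 := by
  rw [lieAd_eq_modelDeriv, show (fun x : G => 1 * x * 1⁻¹) = id by ext; simp]
  exact mfderiv_id

theorem contMDiff_conj {n : ℕ∞ω} [LieGroup 𝓘(𝕜, 𝔤) n G] (g : G) :
    ContMDiff 𝓘(𝕜, 𝔤) 𝓘(𝕜, 𝔤) n (fun x : G => g * x * g⁻¹) :=
  (contMDiff_const.mul contMDiff_id).mul contMDiff_const

theorem mdifferentiableAt_conj [LieGroup 𝓘(𝕜, 𝔤) 1 G] (g x : G) :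
    MDifferentiableAt 𝓘(𝕜, 𝔤) 𝓘(𝕜, 𝔤) (fun x : G => g * x * g⁻¹) x :=
  ((contMDiff_conj (n := 1) g) x).mdifferentiableAt one_ne_zero

theorem lieAd_mul [LieGroup 𝓘(𝕜, 𝔤) 1 G] (g h : G) :
    lieAd 𝕜 (g * h) = (lieAd 𝕜 g).comp (lieAd (𝔤 := 𝔤) 𝕜 h) := by
  have h1 : (fun x : G => g * h * x * (g * h)⁻¹)
      = (fun x : G => g * x * g⁻¹) ∘ (fun x : G => h * x * h⁻¹) := by
    ext x; simp [mul_assoc]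
  rw [lieAd_eq_modelDeriv, h1,
    modelDeriv_comp (mdifferentiableAt_conj g _) (mdifferentiableAt_conj h 1),
    lieAd_eq_modelDeriv, lieAd_eq_modelDeriv, mul_one, mul_inv_cancel]

/-- Differentiating the `C^2` map `(g, x) ↦ g x g⁻¹` in `x` costs one order. For `𝕜 = ℂ` this makes
the derivative of `g ↦ Ad_g A` at `1` `ℂ`-linear. -/
theorem contMDiffAt_lieAd_apply [LieGroup 𝓘(𝕜, 𝔤) 2 G] (A : 𝔤) :
    ContMDiffAt 𝓘(𝕜, 𝔤) 𝓘(𝕜, 𝔤) 1 (fun g : G => lieAd 𝕜 g A) 1 := by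
  have : LieGroup 𝓘(𝕜, 𝔤) 1 G := LieGroup.of_le (n := 2) one_le_two
  have hf : ContMDiff (𝓘(𝕜, 𝔤).prod 𝓘(𝕜, 𝔤)) 𝓘(𝕜, 𝔤) 2
      (Function.uncurry (fun g x : G => g * x * g⁻¹)) :=
    (contMDiff_fst.mul contMDiff_snd).mul contMDiff_fst.inv
  have key := ContMDiffAt.mfderiv_apply (𝕜 := 𝕜) (n := 2) (m := 1) (x₀ := (1 : G))
    (fun g x : G => g * x * g⁻¹) (fun _ => 1) id (fun _ => A) (hf _) contMDiffAt_const
    contMDiffAt_id contMDiffAt_const (by norm_num [one_add_one_eq_two])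
  refine key.congr_of_eventuallyEq (Filter.Eventually.of_forall fun g => ?_)
  -- The base point `g * 1 * g⁻¹` equals `1` only propositionally; once this is used, the coordinate
  -- changes are the identity.
  have hself : ∀ (y y₀ : G), y = y₀ → ∀ v : 𝔤,
      (tangentBundleCore 𝓘(𝕜, 𝔤) G).coordChange (achart 𝔤 y) (achart 𝔤 y₀) y v = v := by
    rintro y _ rfl v
    exact (tangentBundleCore 𝓘(𝕜, 𝔤) G).coordChange_self _ _ (mem_chart_source 𝔤 y) v
  have hg : g * 1 * g⁻¹ = 1 := by simp
  have h1 : (1 : G) * 1 * 1⁻¹ = 1 := by simp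
  change lieAd 𝕜 g A = inTangentCoordinates 𝓘(𝕜, 𝔤) 𝓘(𝕜, 𝔤) (fun _ : G => (1 : G))
    (fun g : G => g * 1 * g⁻¹) (fun g => lieAd 𝕜 g) 1 g A
  rw [inTangentCoordinates_eq]
  · simp only [ContinuousLinearMap.comp_apply]
    rw [hself _ _ (hg.trans h1.symm), hself _ _ rfl]
  · exact mem_chart_source 𝔤 _
  · rw [hg, h1]; exact mem_chart_source 𝔤 _

end Adjoint

/-! ### The splitting `𝔤 = 𝔨 + √-1 𝔨` and the complexified pairing. -/

section Complexification

variable {𝔨 𝔤 V : Type*} [NormedAddCommGroup 𝔨] [NormedSpace ℝ 𝔨]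
  [NormedAddCommGroup 𝔤] [NormedSpace ℂ 𝔤] [NormedAddCommGroup V] [NormedSpace ℂ V]
  {K : Type*} [TopologicalSpace K] [ChartedSpace 𝔨 K] [Group K]
  {G : Type*} [TopologicalSpace G] [ChartedSpace 𝔤 G] [Group G]
  {Z : Type*} [TopologicalSpace Z] [ChartedSpace V Z] [MulAction G Z]

theorem IsComplexification.mdifferentiableAt {ι : K →* G}
    (hι : IsComplexification (𝔨 := 𝔨) (𝔤 := 𝔤) ι) (k : K) :
    MDifferentiableAt 𝓘(ℝ, 𝔨) 𝓘(ℝ, 𝔤) ι k :=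
  (hι.smooth k).mdifferentiableAt (by simp)

/-- Differentiate `ι (k x k⁻¹) = ι k * ι x * (ι k)⁻¹` at `x = 1`. -/
theorem IsComplexification.lieDiff_lieAd [LieGroup 𝓘(ℝ, 𝔨) 1 K] [LieGroup 𝓘(ℂ, 𝔤) 1 G]
    {ι : K →* G} (hι : IsComplexification (𝔨 := 𝔨) (𝔤 := 𝔤) ι) (k : K) (a : 𝔨) :
    (lieDiff ι (lieAd ℝ k a) : 𝔤) = lieAd ℂ (ι k) (lieDiff ι a : 𝔤) := by
  have hc := mdifferentiableAt_conj (𝕜 := ℂ) (𝔤 := 𝔤) (ι k) (ι 1)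
  have h1 : ι ∘ (fun x : K => k * x * k⁻¹) = (fun x : G => ι k * x * (ι k)⁻¹) ∘ ι := by
    ext x; simp
  have h2 := modelDeriv_comp (hι.mdifferentiableAt _) (mdifferentiableAt_conj (𝕜 := ℝ) k 1)
  rw [h1, modelDeriv_comp hc.complexToReal (hι.mdifferentiableAt _),
    modelDeriv_restrictScalars hc, mul_one, mul_inv_cancel, map_one] at h2
  exact (DFunLike.congr_fun h2 a).symm

theorem IsComplexification.exists_eq_add {ι : K →* G}
    (hι : IsComplexification (𝔨 := 𝔨) (𝔤 := 𝔤) ι) (A : 𝔤) :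
    ∃ a b : 𝔨, A = lieDiff ι a + Complex.I • (lieDiff ι b : 𝔤) := by
  refine hι.isBaseChange.inductionOn A
    (fun A => ∃ a b : 𝔨, A = lieDiff ι a + Complex.I • (lieDiff ι b : 𝔤))
    ⟨0, 0, by simp⟩ (fun a => ⟨a, 0, by simp⟩) ?_ ?_
  · rintro s _ ⟨a, b, rfl⟩
    refine ⟨s.re • a - s.im • b, s.im • a + s.re • b, ?_⟩
    have hs : s = (s.re : ℂ) + (s.im : ℂ) * Complex.I := (Complex.re_add_im s).symm
    simp only [map_add, map_sub, map_smul, ← Complex.coe_smul]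
    conv_lhs => rw [hs]
    have hI := Complex.I_mul_I
    match_scalars
    · ring
    · linear_combination (s.im : ℂ) * hI
  · rintro _ _ ⟨a, b, rfl⟩ ⟨c, d, rfl⟩
    exact ⟨a + c, b + d, by simp only [map_add, smul_add]; abel⟩

section Pairing

variable {ι : K →* G} (hι : IsComplexification (𝔨 := 𝔨) (𝔤 := 𝔤) ι)

theorem complexPairing_lieDiff (α : 𝔨 →L[ℝ] ℝ) (a : 𝔨) :
    complexPairing hι α (lieDiff ι a) = α a :=
  hι.isBaseChange.lift_eq _ a

theorem complexPairing_add (α : 𝔨 →L[ℝ] ℝ) (A B : 𝔤) :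
    complexPairing hι α (A + B) = complexPairing hι α A + complexPairing hι α B :=
  map_add _ _ _

theorem complexPairing_smul (α : 𝔨 →L[ℝ] ℝ) (c : ℂ) (A : 𝔤) :
    complexPairing hι α (c • A) = c * complexPairing hι α A :=
  map_smul (hι.isBaseChange.lift (Complex.ofRealCLM.toLinearMap ∘ₗ α.toLinearMap)) c A

theorem complexPairing_apply (α : 𝔨 →L[ℝ] ℝ) (a b : 𝔨) :
    complexPairing hι α (lieDiff ι a + Complex.I • (lieDiff ι b : 𝔤)) =
      α a + Complex.I * α b := by
  rw [complexPairing_add, complexPairing_smul, complexPairing_lieDiff, complexPairing_lieDiff]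

/-- The pairing of `𝔨*` with `𝔤 = 𝔨 ⊗ ℂ` as a real bilinear map. -/
noncomputable def complexPairingBilin : (𝔨 →L[ℝ] ℝ) →ₗ[ℝ] 𝔤 →ₗ[ℝ] ℂ :=
  LinearMap.mk₂ ℝ (complexPairing hι)
    (fun α β A => by
      obtain ⟨a, b, rfl⟩ := hι.exists_eq_add A
      simp only [complexPairing_apply, add_apply, Complex.ofReal_add]
      ring)
    (fun r α A => by
      obtain ⟨a, b, rfl⟩ := hι.exists_eq_add A
      simp only [complexPairing_apply, smul_apply, smul_eq_mul,
        Complex.ofReal_mul, Complex.real_smul]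
      ring)
    (complexPairing_add hι)
    (fun r α A => by
      rw [← Complex.coe_smul r A, complexPairing_smul, Complex.real_smul])

theorem IsMomentMap.complexPairing_smul_lieAd [LieGroup 𝓘(ℝ, 𝔨) 1 K] [LieGroup 𝓘(ℂ, 𝔤) 1 G]
    {Ω : TwoForm V Z} {μ : Z → 𝔨 →L[ℝ] ℝ} (hμ : IsMomentMap ι Ω μ) (k : K) (z : Z) (A : 𝔤) :
    complexPairing hι (μ (ι k • z)) (lieAd ℂ (ι k) A) = complexPairing hι (μ z) A := by
  obtain ⟨a, b, rfl⟩ := hι.exists_eq_add A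
  rw [map_add, map_smul, ← hι.lieDiff_lieAd, ← hι.lieDiff_lieAd, complexPairing_apply,
    complexPairing_apply, hμ.equivariant, hμ.equivariant]

end Pairing

end Complexification

/-! ### Infinitesimal actions, stabilizers and the moment map. -/

section Action

variable {𝔨 𝔤 V : Type*} [NormedAddCommGroup 𝔨] [NormedSpace ℝ 𝔨]
  [NormedAddCommGroup 𝔤] [NormedSpace ℂ 𝔤] [NormedAddCommGroup V] [NormedSpace ℂ V]
  {K : Type*} [TopologicalSpace K] [ChartedSpace 𝔨 K] [Group K]
  {G : Type*} [TopologicalSpace G] [ChartedSpace 𝔤 G] [Group G]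
  {Z : Type*} [TopologicalSpace Z] [ChartedSpace V Z] [MulAction G Z]

theorem complexInfinitesimalAction_eq_modelDeriv (z : Z) :
    complexInfinitesimalAction G z = modelDeriv ℂ 𝔤 V (fun g : G => g • z) 1 := rfl

theorem mdifferentiableAt_orbit
    (hact : ContMDiff (𝓘(ℂ, 𝔤).prod 𝓘(ℂ, V)) 𝓘(ℂ, V) ω (fun p : G × Z => p.1 • p.2))
    (z : Z) (g : G) :
    MDifferentiableAt 𝓘(ℂ, 𝔤) 𝓘(ℂ, V) (fun g : G => g • z) g := by
  have h : ContMDiff 𝓘(ℂ, 𝔤) 𝓘(ℂ, V) ω (fun g : G => g • z) :=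
    hact.comp (contMDiff_id.prodMk contMDiff_const)
  exact (h g).mdifferentiableAt (by simp)

theorem mdifferentiableAt_const_smul
    (hact : ContMDiff (𝓘(ℂ, 𝔤).prod 𝓘(ℂ, V)) 𝓘(ℂ, V) ω (fun p : G × Z => p.1 • p.2))
    (g : G) (z : Z) :
    MDifferentiableAt 𝓘(ℂ, V) 𝓘(ℂ, V) (fun z : Z => g • z) z := by
  have h : ContMDiff 𝓘(ℂ, V) 𝓘(ℂ, V) ω (fun z : Z => g • z) :=
    hact.comp (contMDiff_const.prodMk contMDiff_id)
  exact (h z).mdifferentiableAt (by simp)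

theorem infinitesimalAction_eq_complexInfinitesimalAction
    (hact : ContMDiff (𝓘(ℂ, 𝔤).prod 𝓘(ℂ, V)) 𝓘(ℂ, V) ω (fun p : G × Z => p.1 • p.2))
    {ι : K →* G}
    (hι : IsComplexification (𝔨 := 𝔨) (𝔤 := 𝔤) ι) (z : Z) (a : 𝔨) :
    (infinitesimalAction ι z a : V) = complexInfinitesimalAction G z (lieDiff ι a : 𝔤) := by
  have h := mdifferentiableAt_orbit hact z (ι 1)
  have h1 := modelDeriv_comp h.complexToReal (hι.mdifferentiableAt 1)
  rw [modelDeriv_restrictScalars h, map_one] at h1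
  exact DFunLike.congr_fun h1 a

/-- Differentiate `(g x g⁻¹)·(g·z) = g·(x·z)` at `x = 1`. -/
theorem lieAd_mem_complexStabilizerLie [LieGroup 𝓘(ℂ, 𝔤) 1 G]
    (hact : ContMDiff (𝓘(ℂ, 𝔤).prod 𝓘(ℂ, V)) 𝓘(ℂ, V) ω (fun p : G × Z => p.1 • p.2))
    {z : Z} {η : 𝔤}
    (hη : η ∈ complexStabilizerLie V G z) (g : G) :
    lieAd ℂ g η ∈ complexStabilizerLie V G (g • z) := by
  have h1 : (fun h : G => h • g • z) ∘ (fun x : G => g * x * g⁻¹)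
      = (fun w : Z => g • w) ∘ (fun h : G => h • z) := by
    ext x; simp [mul_smul]
  have h2 := modelDeriv_comp (f := fun x : G => g * x * g⁻¹)
    (mdifferentiableAt_orbit hact (g • z) (g * 1 * g⁻¹)) (mdifferentiableAt_conj g 1)
  rw [h1, modelDeriv_comp (mdifferentiableAt_const_smul hact g _)
    (mdifferentiableAt_orbit hact z 1), mul_one, mul_inv_cancel] at h2
  have h3 : complexInfinitesimalAction G z η = (0 : V) := hη
  have h4 := DFunLike.congr_fun h2 η
  rw [ContinuousLinearMap.comp_apply, ← complexInfinitesimalAction_eq_modelDeriv, h3,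
    map_zero] at h4
  exact h4.symm

theorem IsMomentMap.modelDeriv_apply {ι : K →* G} {Ω : TwoForm V Z} {μ : Z → 𝔨 →L[ℝ] ℝ}
    (hμ : IsMomentMap ι Ω μ) (z : Z) (v : V) (a : 𝔨) :
    modelDeriv ℝ V (𝔨 →L[ℝ] ℝ) μ z v a = Ω z ![v, infinitesimalAction ι z a] := by
  have h1 := (hμ.smooth z).mdifferentiableAt (by simp)
  have h2 : HasMFDerivAt 𝓘(ℝ, 𝔨 →L[ℝ] ℝ) 𝓘(ℝ, ℝ) (fun α : 𝔨 →L[ℝ] ℝ => α a) (μ z)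
      (ContinuousLinearMap.apply ℝ ℝ a) :=
    (ContinuousLinearMap.apply ℝ ℝ a : (𝔨 →L[ℝ] ℝ) →L[ℝ] ℝ).hasFDerivAt.hasMFDerivAt
  have h3 := modelDeriv_comp h2.mdifferentiableAt h1
  rw [h2.modelDeriv_eq] at h3
  rw [← hμ.differential]
  exact (DFunLike.congr_fun h3 v).symm

/-- Write `η = c + √-1 d`. Then `σ_z η = 0` forces `σ_z d = J σ_z c`, and with `x = σ_z c` the
pairing is `Ω(v, x) + √-1 Ω(v, J x)`, which is `ℂ`-linear in `v` by `J`-invariance. -/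
theorem IsKahlerForm.complexPairing_modelDeriv_I_smul
    (hact : ContMDiff (𝓘(ℂ, 𝔤).prod 𝓘(ℂ, V)) 𝓘(ℂ, V) ω (fun p : G × Z => p.1 • p.2))
    {ι : K →* G} (hι : IsComplexification (𝔨 := 𝔨) (𝔤 := 𝔤) ι)
    {Ω : TwoForm V Z} {μ : Z → 𝔨 →L[ℝ] ℝ} (hΩ : IsKahlerForm Ω) (hμ : IsMomentMap ι Ω μ)
    {z : Z} {η : 𝔤} (hη : η ∈ complexStabilizerLie V G z) (v : V) :
    complexPairing hι (modelDeriv ℝ V (𝔨 →L[ℝ] ℝ) μ z (Complex.I • v)) η =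
      Complex.I * complexPairing hι (modelDeriv ℝ V (𝔨 →L[ℝ] ℝ) μ z v) η := by
  obtain ⟨c, d, rfl⟩ := hι.exists_eq_add η
  have h0 : complexInfinitesimalAction G z
      (lieDiff ι c + Complex.I • (lieDiff ι d : 𝔤)) = (0 : V) := hη
  rw [map_add, map_smul, ← infinitesimalAction_eq_complexInfinitesimalAction hact hι,
    ← infinitesimalAction_eq_complexInfinitesimalAction hact hι] at h0
  simp only [complexPairing_apply, hμ.modelDeriv_apply]
  set x : V := infinitesimalAction ι z c
  set y : V := infinitesimalAction ι z d
  have hy : y = Complex.I • x := by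
    rw [eq_neg_of_add_eq_zero_left h0, smul_neg, smul_smul, Complex.I_mul_I, neg_one_smul, neg_neg]
  have h1 : Ω z ![Complex.I • v, y] = Ω z ![v, x] := by rw [hy, hΩ.complex_invariant]
  have h2 : Ω z ![Complex.I • v, x] = - Ω z ![v, y] := by
    rw [← hΩ.complex_invariant, smul_smul, Complex.I_mul_I, ← hy]
    simpa using (Ω z).vecCons_smul ![y] (-1) v
  rw [h1, h2]
  push_cast
  linear_combination -(Ω z ![v, y] : ℂ) * Complex.I_mul_I

/-! ### Constancy of the moment map term. -/

section Derivative

variable [FiniteDimensional ℝ 𝔨] [FiniteDimensional ℂ 𝔤] [LieGroup 𝓘(ℝ, 𝔨) 1 K]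
  [LieGroup 𝓘(ℂ, 𝔤) 2 G]
  {ι : K →* G} (hι : IsComplexification (𝔨 := 𝔨) (𝔤 := 𝔤) ι)
  {Ω : TwoForm V Z} {μ : Z → 𝔨 →L[ℝ] ℝ}

theorem hasMFDerivAt_complexPairing_lieAd_one
    (hact : ContMDiff (𝓘(ℂ, 𝔤).prod 𝓘(ℂ, V)) 𝓘(ℂ, V) ω (fun p : G × Z => p.1 • p.2))
    (hΩ : IsKahlerForm Ω) (hμ : IsMomentMap ι Ω μ)
    {z : Z} {η : 𝔤} (hη : η ∈ complexStabilizerLie V G z) :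
    HasMFDerivAt 𝓘(ℝ, 𝔤) 𝓘(ℝ, ℂ)
      (fun g : G => complexPairing hι (μ (g • z)) (lieAd ℂ g η)) 1 (0 : 𝔤 →L[ℝ] ℂ) := by
  have : FiniteDimensional ℝ 𝔤 := FiniteDimensional.complexToReal 𝔤
  have : LieGroup 𝓘(ℂ, 𝔤) 1 G := LieGroup.of_le (n := 2) one_le_two
  set B := (complexPairingBilin hι).toContinuousBilinearMap
  have hB : ∀ α A, B α A = complexPairing hι α A := fun _ _ => rfl
  set D : 𝔤 →L[ℂ] 𝔤 := modelDeriv ℂ 𝔤 𝔤 (fun g : G => lieAd ℂ g η) 1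
  have hAd : HasMFDerivAt 𝓘(ℝ, 𝔤) 𝓘(ℝ, 𝔤) (fun g : G => lieAd ℂ g η) 1
      (D.restrictScalars ℝ) :=
    ((contMDiffAt_lieAd_apply η).mdifferentiableAt
      one_ne_zero).hasMFDerivAt_modelDeriv.complexToReal
  set σ : 𝔤 →L[ℂ] V := complexInfinitesimalAction G z
  have hσ : HasMFDerivAt 𝓘(ℝ, 𝔤) 𝓘(ℝ, V) (fun g : G => g • z) 1 (σ.restrictScalars ℝ) :=
    (mdifferentiableAt_orbit hact z 1).hasMFDerivAt_modelDeriv.complexToReal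
  set T := modelDeriv ℝ V (𝔨 →L[ℝ] ℝ) μ z
  have hT : HasMFDerivAt 𝓘(ℝ, V) 𝓘(ℝ, 𝔨 →L[ℝ] ℝ) μ ((1 : G) • z) T := by
    rw [one_smul]
    exact ((hμ.smooth z).mdifferentiableAt (by simp)).hasMFDerivAt_modelDeriv
  have hμσ := hT.comp (1 : G) hσ
  -- The product rule for the bilinear pairing, with `Ad_1 = id`.
  obtain ⟨L, hL, hLe⟩ : ∃ L : 𝔤 →L[ℝ] ℂ, HasMFDerivAt 𝓘(ℝ, 𝔤) 𝓘(ℝ, ℂ)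
      (fun g : G => complexPairing hι (μ (g • z)) (lieAd ℂ g η)) 1 L ∧
      ∀ ζ, L ζ = complexPairing hι (μ z) (D ζ) + complexPairing hι (T (σ ζ)) η := by
    refine ⟨B.precompR 𝔤 (μ z) (D.restrictScalars ℝ) +
      B.precompL 𝔤 (T.comp (σ.restrictScalars ℝ)) η, ⟨?_, ?_⟩, fun ζ => rfl⟩
    · exact (B.continuous₂.continuousAt.comp (hμσ.1.prodMk hAd.1) :)
    · convert! B.hasFDerivWithinAt_of_bilinear hμσ.2 hAd.2 using 3
      simp [writtenInExtChartAt, lieAd_one, hB, Function.comp_def, chartAt_self_eq]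
      rfl
  have hLI : ∀ ζ, L (Complex.I • ζ) = Complex.I * L ζ := fun ζ => by
    rw [hLe, hLe, map_smul, map_smul, complexPairing_smul,
      hΩ.complexPairing_modelDeriv_I_smul hact hι hμ hη, mul_add]
  -- By equivariance the function composed with `ι` is constant.
  have hLk : ∀ a : 𝔨, L (lieDiff ι a) = 0 := fun a => by
    have h1 := modelDeriv_comp (f := ι) (x := (1 : K)) (by rw [map_one]; exact hL.mdifferentiableAt)
      (hι.mdifferentiableAt 1)
    have h2 : (fun g : G => complexPairing hι (μ (g • z)) (lieAd ℂ g η)) ∘ ι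
        = fun _ => complexPairing hι (μ z) η := by
      ext k; exact hμ.complexPairing_smul_lieAd hι k z η
    rw [h2, modelDeriv_const, map_one, hL.modelDeriv_eq] at h1
    exact (DFunLike.congr_fun h1 a).symm
  have hL0 : L = 0 := by
    ext ζ
    obtain ⟨a, b, rfl⟩ := hι.exists_eq_add ζ
    rw [map_add, hLI, hLk, hLk]; simp
  exact hL0 ▸ hL

/-- The case `g = 1`, applied to `g·z` and `Ad_g η ∈ 𝔤_{g·z}`, is pulled back along `h ↦ h g⁻¹`. -/
theorem hasMFDerivAt_complexPairing_lieAd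
    (hact : ContMDiff (𝓘(ℂ, 𝔤).prod 𝓘(ℂ, V)) 𝓘(ℂ, V) ω (fun p : G × Z => p.1 • p.2))
    (hΩ : IsKahlerForm Ω) (hμ : IsMomentMap ι Ω μ)
    {z : Z} {η : 𝔤} (hη : η ∈ complexStabilizerLie V G z) (g : G) :
    HasMFDerivAt 𝓘(ℝ, 𝔤) 𝓘(ℝ, ℂ)
      (fun g : G => complexPairing hι (μ (g • z)) (lieAd ℂ g η)) g (0 : 𝔤 →L[ℝ] ℂ) := by
  have : LieGroup 𝓘(ℂ, 𝔤) 1 G := LieGroup.of_le (n := 2) one_le_two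
  have h1 := hasMFDerivAt_complexPairing_lieAd_one hι hact hΩ hμ
    (lieAd_mem_complexStabilizerLie hact hη g)
  have h2 : MDifferentiableAt 𝓘(ℂ, 𝔤) 𝓘(ℂ, 𝔤) (fun h : G => h * g⁻¹) g :=
    ((contMDiff_mul_right (I := 𝓘(ℂ, 𝔤)) (n := 1) (a := g⁻¹)) g).mdifferentiableAt one_ne_zero
  rw [← mul_inv_cancel g] at h1
  have h3 := h1.comp g h2.complexToReal.hasMFDerivAt_modelDeriv
  have h4 : (fun h : G => complexPairing hι (μ (h • g • z)) (lieAd ℂ h (lieAd ℂ g η))) ∘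
      (fun h : G => h * g⁻¹) = fun g : G => complexPairing hι (μ (g • z)) (lieAd ℂ g η) := by
    ext h
    simp only [Function.comp_apply]
    rw [← ContinuousLinearMap.comp_apply, ← lieAd_mul, ← mul_smul, inv_mul_cancel_right]
  rw [h4] at h3
  exact h3

/-- A locally constant function takes the same value at `g` as at a point of `K` in its component,
where equivariance evaluates it. -/
theorem complexPairing_lieAd_eq
    (hact : ContMDiff (𝓘(ℂ, 𝔤).prod 𝓘(ℂ, V)) 𝓘(ℂ, V) ω (fun p : G × Z => p.1 • p.2))
    (hΩ : IsKahlerForm Ω) (hμ : IsMomentMap ι Ω μ)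
    {z : Z} {η : 𝔤} (hη : η ∈ complexStabilizerLie V G z) (g : G) :
    complexPairing hι (μ (g • z)) (lieAd ℂ g η) = complexPairing hι (μ z) η := by
  have : LieGroup 𝓘(ℂ, 𝔤) 1 G := LieGroup.of_le (n := 2) one_le_two
  have hloc := isLocallyConstant_of_hasMFDerivAt_zero
    (hasMFDerivAt_complexPairing_lieAd hι hact hΩ hμ hη)
  obtain ⟨k, hk⟩ := hι.meets_components g
  rw [hloc.apply_eq_of_isPreconnected isPreconnected_connectedComponent hk mem_connectedComponent]
  exact hμ.complexPairing_smul_lieAd hι k z η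

end Derivative

/-- `Ad_g` is linear, hence its own derivative, so this is the chain rule for `φ ∘ Ad_g = φ`. -/
theorem fderiv_lieAd_apply {φ : 𝔤 → ℝ} (hφ : Differentiable ℝ φ)
    (hφ_inv : ∀ (g : G) (A : 𝔤), φ (lieAd ℂ g A) = φ A) (g : G) (A B : 𝔤) :
    fderiv ℝ φ (lieAd ℂ g A) (lieAd ℂ g B) = fderiv ℝ φ A B := by
  have h := (hφ (lieAd ℂ g A)).hasFDerivAt.comp A
    ((lieAd ℂ g : 𝔤 →L[ℂ] 𝔤).restrictScalars ℝ).hasFDerivAt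
  rw [show φ ∘ lieAd ℂ g = φ from funext (hφ_inv g)] at h
  rw [h.fderiv]
  rfl

end Action
theorem theorem3p8
    {𝔨 𝔤 V : Type*}
    [NormedAddCommGroup 𝔨] [NormedSpace ℝ 𝔨] [FiniteDimensional ℝ 𝔨]
    [NormedAddCommGroup 𝔤] [NormedSpace ℂ 𝔤] [FiniteDimensional ℂ 𝔤]
    [NormedAddCommGroup V] [NormedSpace ℂ V] [FiniteDimensional ℂ V]
    -- the compact Lie group `K`, its complexification `G`
    {K : Type*} [TopologicalSpace K] [ChartedSpace 𝔨 K] [Group K] [LieGroup 𝓘(ℝ, 𝔨) ∞ K]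
    [CompactSpace K]
    {G : Type*} [TopologicalSpace G] [ChartedSpace 𝔤 G] [Group G] [LieGroup 𝓘(ℂ, 𝔤) ω G]
    (ι : K →* G) (hι : IsComplexification (𝔨 := 𝔨) (𝔤 := 𝔤) ι)
    -- the Kähler manifold `Z` with a holomorphic action of `G`, Hamiltonian for `K`
    {Z : Type*} [TopologicalSpace Z] [ChartedSpace V Z] [IsManifold 𝓘(ℂ, V) ω Z]
    (Ω : TwoForm V Z) (hΩ : IsKahlerForm Ω)
    [MulAction G Z]
    (hact : ContMDiff (𝓘(ℂ, 𝔤).prod 𝓘(ℂ, V)) 𝓘(ℂ, V) ω (fun p : G × Z => p.1 • p.2))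
    (hK : PreservesForm ι Ω)
    (μ : Z → 𝔨 →L[ℝ] ℝ) (hμ : IsMomentMap ι Ω μ)
    -- the point, the stabilizer elements and the `Ad_G`-invariant function
    (z : Z) (ξ : 𝔨) (hξ : ξ ∈ stabilizerLie (V := V) ι z)
    (η : 𝔤) (hη : η ∈ complexStabilizerLie V G z)
    (φ : 𝔤 → ℝ) (hφ : Differentiable ℝ φ)
    (hφ_inv : ∀ (g : G) (A : 𝔤), φ (lieAd ℂ g A) = φ A) :
    (∀ g₁ g₂ : G,
      fderiv ℝ φ (lieAd ℂ g₁ (lieDiff ι ξ)) (lieAd ℂ g₁ η) =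
        fderiv ℝ φ (lieAd ℂ g₂ (lieDiff ι ξ)) (lieAd ℂ g₂ η)) ∧
    (∀ g₁ g₂ : G, muInvariant hι μ φ z ξ η g₁ = muInvariant hι μ φ z ξ η g₂) := by
  have : LieGroup 𝓘(ℝ, 𝔨) 1 K := LieGroup.of_le (n := ∞) (by simp)
  have : LieGroup 𝓘(ℂ, 𝔤) 2 G := LieGroup.of_le (n := ω) le_top
  have h1 := fun g : G => fderiv_lieAd_apply hφ hφ_inv g (lieDiff ι ξ) η
  have h2 := fun g : G => complexPairing_lieAd_eq hι hact hΩ hμ hη g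
  exact ⟨fun g₁ g₂ => by rw [h1, h1],
    fun g₁ g₂ => by simp only [muInvariant, h1, h2]⟩
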